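/- Let $f:\{0,1\}^n\times\{0,1\}^m\to\{0,1\}$ be a partial or total Boolean function; Alice holds $x$ and Bob holds $y$. In a one-way quantum protocol with $a$ qubits, Alice sends Bob an $a$-qubit pure state $|\psi_x\rangle$, and Bob applies a two-outcome measurement (POVM) depending on $y$ and outputs 1 if it accepts and 0 otherwise. Let $Q^1(f)$ be the minimal $a$ for which some such protocol outputs $f(x,y)$ with probability at least $2/3$ for every $(x,y)$ in the domain of $f$. For an integer $w\ge 0$, let $\mathrm{QMA}^1_w(f)$ be the minimal $a$ for which there is a protocol in which Alice sends Bob an $a$-qubit pure state $|\psi_x\rangle$, Merlin sends Bob a $w$-qubit pure state $|\phi\rangle$, and Bob applies a two-outcome measurement (POVM) depending on $y$ to $|\psi_x\rangle\otimes|\phi\rangle$, such that for every $(x,y)$ in the domain of $f$: if $f(x,y)=1$, then there exists $|\phi\rangle$ for which Bob accepts with probability at least $2/3$; if $f(x,y)=0$, then for all $|\phi\rangle$ Bob accepts with probability at most $1/3$. Then there is a universal constant $C>0$ such that for all $n,m\ge 0$, all partial or total Boolean functions $f:\{0,1\}^n\times\{0,1\}^m\to\{0,1\}$ and all integers $w\ge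 2$, \[ Q^1(f)\le C\cdot \mathrm{QMA}^1_w(f)\cdot w\log^2 w. \] -/

import Mathlib

open scoped Matrix ComplexOrder

/-- Bit strings of length `n`; they also label the computational basis of `n` qubits. -/
abbrev Bits (n : ℕ) : Type := Fin n → Bool

/-- A possibly partial Boolean function of Alice's input `x` and Bob's input `y`:
`f x y = none` means that `f` is undefined at `(x, y)`. -/
abbrev PartialBoolFun (n m : ℕ) : Type := Bits n → Bits m → Option Bool

/-- `ψ` is a unit vector, given by its amplitudes in the orthonormal basis labelled by `ι`. -/
def IsPureState {ι : Type*} [Fintype ι] (ψ : ι → ℂ) : Prop :=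
  ∑ i, ‖ψ i‖ ^ 2 = 1

/-- `Γ` is the accepting operator of a two-outcome POVM `{Γ, I - Γ}`, i.e. `0 ≤ Γ ≤ I`. -/
def IsMeasurementOperator {ι : Type*} [Fintype ι] [DecidableEq ι] (Γ : Matrix ι ι ℂ) : Prop :=
  Γ.PosSemidef ∧ (1 - Γ).PosSemidef

/-- The probability `⟨ψ|Γ|ψ⟩` that the measurement `{Γ, I - Γ}` accepts the pure state `ψ`. -/
noncomputable def acceptProb {ι : Type*} [Fintype ι] (Γ : Matrix ι ι ℂ) (ψ : ι → ℂ) : ℝ :=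
  (star ψ ⬝ᵥ (Γ *ᵥ ψ)).re

/-- The product state `ψ ⊗ φ`. -/
def tensorState {ι κ : Type*} (ψ : ι → ℂ) (φ : κ → ℂ) : ι × κ → ℂ :=
  fun p => ψ p.1 * φ p.2

/-- A one-way quantum protocol without Merlin: on input `x` Alice sends the `a`-qubit state
`message x`; on input `y` Bob applies the measurement with accepting operator `measure y`,
and outputs 1 if it accepts and 0 otherwise. -/
structure OneWayProtocol (n m a : ℕ) where
  message : Bits n → (Bits a → ℂ)
  message_pure : ∀ x, IsPureState (message x)
  measure : Bits m → Matrix (Bits a) (Bits a) ℂ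
  measure_isMeasurement : ∀ y, IsMeasurementOperator (measure y)

/-- On every input where `f` is defined, Bob outputs `f x y` with probability at least `2/3`
(the probability of output 0 is `1 - acceptProb`). -/
def OneWayProtocol.Computes {n m a : ℕ} (P : OneWayProtocol n m a) (f : PartialBoolFun n m) :
    Prop :=
  ∀ x y,
    (f x y = some true → 2 / 3 ≤ acceptProb (P.measure y) (P.message x)) ∧
    (f x y = some false → 2 / 3 ≤ 1 - acceptProb (P.measure y) (P.message x))

/-- A one-way quantum protocol with Merlin: on input `x` Alice sends the `a`-qubit state
`message x`, Merlin sends a `w`-qubit state, and on input `y` Bob measures both messages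
jointly with accepting operator `measure y`. -/
structure MerlinProtocol (n m a w : ℕ) where
  message : Bits n → (Bits a → ℂ)
  message_pure : ∀ x, IsPureState (message x)
  measure : Bits m → Matrix (Bits a × Bits w) (Bits a × Bits w) ℂ
  measure_isMeasurement : ∀ y, IsMeasurementOperator (measure y)

/-- Completeness `2/3` (some witness, which may depend on `x` and `y`) and soundness `1/3`
(all witnesses) on every input where `f` is defined. -/
def MerlinProtocol.Verifies {n m a w : ℕ} (P : MerlinProtocol n m a w)
    (f : PartialBoolFun n m) : Prop :=
  ∀ x y,
    (f x y = some true → ∃ φ : Bits w → ℂ, IsPureState φ ∧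
      2 / 3 ≤ acceptProb (P.measure y) (tensorState (P.message x) φ)) ∧
    (f x y = some false → ∀ φ : Bits w → ℂ, IsPureState φ →
      acceptProb (P.measure y) (tensorState (P.message x) φ) ≤ 1 / 3)

/-- The bounded-error one-way quantum communication complexity `Q¹(f)`. -/
noncomputable def Q1 {n m : ℕ} (f : PartialBoolFun n m) : ℕ :=
  sInf {a : ℕ | ∃ P : OneWayProtocol n m a, P.Computes f}

/-- `QMA¹_w(f)`: the least number of qubits Alice sends in a protocol verifying `f` in which
Merlin sends `w` qubits. -/
noncomputable def QMA1 {n m : ℕ} (w : ℕ) (f : PartialBoolFun n m) : ℕ :=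
  sInf {a : ℕ | ∃ P : MerlinProtocol n m a w, P.Verifies f}

/-! The minima above are over nonempty sets: Alice can send `x` itself as a basis state. -/

theorem isPureState_single {ι : Type*} [Fintype ι] [DecidableEq ι] (i : ι) :
    IsPureState (Pi.single i 1 : ι → ℂ) := by
  unfold IsPureState
  rw [Finset.sum_eq_single i]
  · simp
  · intro j _ hj
    simp [Pi.single_eq_of_ne hj]
  · simp

theorem isMeasurementOperator_diagonal {ι : Type*} [Fintype ι] [DecidableEq ι]
    (p : ι → Prop) [DecidablePred p] :
    IsMeasurementOperator (Matrix.diagonal fun i => if p i then (1 : ℂ) else 0) := by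
  constructor
  · refine Matrix.PosSemidef.diagonal fun i => ?_
    by_cases h : p i <;> simp [h]
  · rw [← Matrix.diagonal_one, Matrix.diagonal_sub]
    refine Matrix.PosSemidef.diagonal fun i => ?_
    by_cases h : p i <;> simp [h]

theorem acceptProb_diagonal {ι : Type*} [Fintype ι] [DecidableEq ι]
    (p : ι → Prop) [DecidablePred p] (ψ : ι → ℂ) :
    acceptProb (Matrix.diagonal fun i => if p i then (1 : ℂ) else 0) ψ =
      ∑ i, if p i then ‖ψ i‖ ^ 2 else 0 := by
  unfold acceptProb
  simp only [dotProduct, Matrix.mulVec_diagonal, Complex.re_sum]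
  refine Finset.sum_congr rfl fun i _ => ?_
  by_cases h : p i
  · simp only [h, if_true, one_mul, Pi.star_apply]
    rw [Complex.star_def, ← Complex.normSq_eq_conj_mul_self, Complex.normSq_eq_norm_sq,
      Complex.ofReal_re]
  · simp [h]

theorem Q1_nonempty {n m : ℕ} (f : PartialBoolFun n m) :
    {a : ℕ | ∃ P : OneWayProtocol n m a, P.Computes f}.Nonempty := by
  refine ⟨n, ⟨fun x => Pi.single x 1, fun x => isPureState_single x,
    fun y => Matrix.diagonal fun x => if f x y = some true then 1 else 0,
    fun y => isMeasurementOperator_diagonal _⟩, fun x y => ⟨fun h => ?_, fun h => ?_⟩⟩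
  · simp only [acceptProb_diagonal]
    rw [Finset.sum_eq_single x]
    · norm_num [h]
    · intro j _ hj
      simp [Pi.single_eq_of_ne hj]
    · simp
  · simp only [acceptProb_diagonal]
    rw [Finset.sum_eq_zero]
    · norm_num
    · intro j _
      by_cases hj : j = x
      · simp [hj, h]
      · simp [Pi.single_eq_of_ne hj]

theorem QMA1_nonempty {n m : ℕ} (w : ℕ) (f : PartialBoolFun n m) :
    {a : ℕ | ∃ P : MerlinProtocol n m a w, P.Verifies f}.Nonempty := by
  refine ⟨n, ⟨fun x => Pi.single x 1, fun x => isPureState_single x,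
    fun y => Matrix.diagonal fun q => if f q.1 y = some true then 1 else 0,
    fun y => isMeasurementOperator_diagonal _⟩, fun x y => ⟨fun h => ?_, fun h φ _ => ?_⟩⟩
  · refine ⟨Pi.single (fun _ => false) 1, isPureState_single _, ?_⟩
    simp only [acceptProb_diagonal]
    rw [Finset.sum_eq_single (x, fun _ => false)]
    · norm_num [h, tensorState]
    · rintro ⟨i, j⟩ _ hij
      by_cases hi : i = x
      · have hj : j ≠ fun _ => false := by
          rintro rfl
          exact hij (by rw [hi])
        simp [tensorState, Pi.single_eq_of_ne hj]
      · simp [tensorState, Pi.single_eq_of_ne hi]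
    · simp
  · simp only [acceptProb_diagonal]
    rw [Finset.sum_eq_zero]
    · norm_num
    · rintro ⟨i, j⟩ _
      by_cases hi : i = x
      · simp [hi, h]
      · simp [tensorState, Pi.single_eq_of_ne hi]

/-! Saturation `Y ↦ 1 - (1 + Y)⁻¹` turns a positive operator into a measurement operator at most
`Y`, and it is operator monotone. Merlin's message is removed in three moves.

*Parallel test.* On `2 * k` copies of both messages, Bob measures the saturation of
`s • (1 + Γ)^⊗(2k)`. Since saturation is below the identity function and `1 - saturate Y ≤ Y⁻¹`,
the soundness and completeness errors are bounded by expressions that factor over the copies, even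
when the witnesses are entangled. With `s = 2⁻ᵏ` both errors are at most `(8/9)ᵏ`.

*Repetition.* With `k` of order `log w`, an accepting witness is hardly disturbed by the test, so
that it can be used again. Repeating the test `r` times, with `r` of order `w`, on fresh messages
of Alice but one witness register brings the soundness error far below the inverse `4^(-w k)` of
the dimension of that register, while the witness does not grow.

*Guessing the witness.* The partial trace of the test over the witness register is then small on
rejected inputs, and it dominates the test with the good witness on accepted ones. Its saturation
is a measurement that needs no witness. Alice's message has grown by the factor `2 * k * r`.
-/

section Saturate

variable {A : Type*} [CStarAlgebra A]

/-- The operator `1 - (1 + Y)⁻¹ = Y (1 + Y)⁻¹`. It turns an arbitrary positive operator `Y` into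
a measurement operator that almost never accepts where `Y` is small and almost always accepts where
`Y` is large. -/
noncomputable def saturate (Y : A) : A :=
  cfc (fun x : ℝ ↦ 1 - (1 + x)⁻¹) Y

theorem continuousOn_inv_one_add : ContinuousOn (fun x : ℝ ↦ (1 + x)⁻¹) (Set.Ici 0) :=
  (continuousOn_const.add continuousOn_id).inv₀ fun _ hx ↦
    (add_pos_of_pos_of_nonneg one_pos hx).ne'

variable [PartialOrder A] [StarOrderedRing A] {Y Z Q : A}

theorem spectrum_subset_Ici_zero (hY : 0 ≤ Y) : spectrum ℝ Y ⊆ Set.Ici 0 :=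
  fun _ hx ↦ spectrum_nonneg_of_nonneg hY hx

theorem one_sub_saturate (hY : 0 ≤ Y) :
    1 - saturate Y = cfc (fun x : ℝ ↦ (1 + x)⁻¹) Y := by
  have hcont := continuousOn_inv_one_add.mono (spectrum_subset_Ici_zero hY)
  rw [saturate, ← cfc_const_one ℝ Y, ← cfc_sub ..]
  simp only [sub_sub_cancel]

theorem saturate_nonneg (hY : 0 ≤ Y) : 0 ≤ saturate Y :=
  cfc_nonneg fun _ hx ↦ sub_nonneg.2 <| inv_le_one_of_one_le₀ <|
    le_add_of_nonneg_right (spectrum_nonneg_of_nonneg hY hx)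

theorem saturate_le_one (hY : 0 ≤ Y) : saturate Y ≤ 1 :=
  cfc_le_one _ _ fun _ hx ↦ sub_le_self _ <| inv_nonneg.2 <|
    add_nonneg zero_le_one (spectrum_nonneg_of_nonneg hY hx)

theorem saturate_le_self (hY : 0 ≤ Y) : saturate Y ≤ Y := by
  have hcont : ContinuousOn (fun x : ℝ ↦ 1 - (1 + x)⁻¹) (spectrum ℝ Y) :=
    continuousOn_const.sub (continuousOn_inv_one_add.mono (spectrum_subset_Ici_zero hY))
  conv_rhs => rw [← cfc_id ℝ Y]
  refine cfc_mono fun x hx ↦ ?_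
  have hx := spectrum_nonneg_of_nonneg hY hx
  rw [id, ← sub_nonneg, show x - (1 - (1 + x)⁻¹) = x ^ 2 * (1 + x)⁻¹ by field_simp; ring]
  positivity

theorem saturate_mono (hY : 0 ≤ Y) (hYZ : Y ≤ Z) : saturate Y ≤ saturate Z := by
  have hZ := hY.trans hYZ
  have hcont {X : A} (hX : 0 ≤ X) :
      ContinuousOn (fun x : ℝ ↦ 1 - (1 + x)⁻¹) (quasispectrum ℝ X) :=
    continuousOn_const.sub (continuousOn_inv_one_add.mono (quasispectrum_nonneg_of_nonneg X hX))
  simpa only [saturate, cfcₙ_eq_cfc (hcont hY), cfcₙ_eq_cfc (hcont hZ)] using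
    CFC.monotoneOn_one_sub_one_add_inv_real hY hZ hYZ

theorem inv_smul_le_saturate {t : ℝ} (hY : 0 ≤ Y) (hYt : Y ≤ algebraMap ℝ A t) :
    (1 + t)⁻¹ • Y ≤ saturate Y := by
  have hcont : ContinuousOn (fun x : ℝ ↦ 1 - (1 + x)⁻¹) (spectrum ℝ Y) :=
    continuousOn_const.sub (continuousOn_inv_one_add.mono (spectrum_subset_Ici_zero hY))
  rw [← cfc_const_mul_id (1 + t)⁻¹ Y]
  refine cfc_mono fun x hx ↦ ?_
  have hxt := (le_algebraMap_iff_spectrum_le).1 hYt x hx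
  have hx := spectrum_nonneg_of_nonneg hY hx
  calc (1 + t)⁻¹ * x ≤ (1 + x)⁻¹ * x := by gcongr
    _ = 1 - (1 + x)⁻¹ := by field_simp; ring

theorem smul_le_saturate {t : ℝ} (ht : 0 ≤ t) (hQ : 0 ≤ Q) (hQ1 : Q ≤ 1) (hY : t • Q ≤ Y) :
    (t / (1 + t)) • Q ≤ saturate Y := by
  have htQ : t • Q ≤ algebraMap ℝ A t := by
    rw [Algebra.algebraMap_eq_smul_one]
    exact smul_le_smul_of_nonneg_left hQ1 ht
  calc (t / (1 + t)) • Q = (1 + t)⁻¹ • t • Q := by rw [smul_smul, div_eq_inv_mul]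
    _ ≤ saturate (t • Q) := inv_smul_le_saturate (smul_nonneg ht hQ) htQ
    _ ≤ saturate Y := saturate_mono (smul_nonneg ht hQ) hY

theorem one_add_mul_one_sub_saturate (hY : 0 ≤ Y) : (1 + Y) * (1 - saturate Y) = 1 := by
  have hcont := continuousOn_inv_one_add.mono (spectrum_subset_Ici_zero hY)
  have hadd : 1 + Y = cfc (fun x : ℝ ↦ 1 + x) Y := by
    rw [cfc_const_add 1 (fun x ↦ x) Y, cfc_id' ℝ Y, map_one]
  rw [one_sub_saturate hY, hadd, ← cfc_mul .., ← cfc_const_one ℝ Y]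
  refine cfc_congr fun x hx ↦ mul_inv_cancel₀ ?_
  exact (add_pos_of_pos_of_nonneg one_pos (spectrum_nonneg_of_nonneg hY hx)).ne'

theorem one_sub_saturate_le_inv (Y : Aˣ) (hY : 0 ≤ (Y : A)) :
    1 - saturate (Y : A) ≤ (Y⁻¹ : Aˣ) := by
  have hcont := continuousOn_inv_one_add.mono (spectrum_subset_Ici_zero hY)
  have hne : ∀ x ∈ spectrum ℝ (Y : A), x ≠ 0 := by
    rintro x hx rfl
    exact spectrum.zero_notMem ℝ Y.isUnit hx
  rw [one_sub_saturate hY, ← cfc_inv_id (R := ℝ) Y]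
  refine cfc_mono (fun x hx ↦ ?_) (hf := hcont) (hg := continuousOn_inv₀.mono hne)
  exact inv_anti₀ ((spectrum_nonneg_of_nonneg hY hx).lt_of_ne' (hne x hx)) (by simp)

end Saturate

section QuadraticForm

open scoped MatrixOrder

variable {ι κ : Type*}

theorem submatrix_mono {A B : Matrix ι ι ℂ} (h : A ≤ B) (e : κ → ι) :
    A.submatrix e e ≤ B.submatrix e e :=
  Matrix.le_iff.2 ((Matrix.le_iff.1 h).submatrix e)

variable [Fintype ι] [Fintype κ]

theorem acceptProb_sub (A B : Matrix ι ι ℂ) (v : ι → ℂ) :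
    acceptProb (A - B) v = acceptProb A v - acceptProb B v := by
  simp only [acceptProb, Matrix.sub_mulVec, dotProduct_sub, Complex.sub_re]

theorem acceptProb_smul (c : ℝ) (A : Matrix ι ι ℂ) (v : ι → ℂ) :
    acceptProb (c • A) v = c * acceptProb A v := by
  simp only [acceptProb, Matrix.smul_mulVec, dotProduct_smul, Complex.smul_re, smul_eq_mul]

theorem acceptProb_smul_vec (A : Matrix ι ι ℂ) (c : ℝ) (v : ι → ℂ) :
    acceptProb A ((c : ℂ) • v) = c ^ 2 * acceptProb A v := by
  simp only [acceptProb, Matrix.mulVec_smul, star_smul, dotProduct_smul, smul_dotProduct,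
    Complex.star_def, Complex.conj_ofReal, smul_eq_mul, Complex.re_ofReal_mul]
  ring

theorem acceptProb_one [DecidableEq ι] (v : ι → ℂ) :
    acceptProb (1 : Matrix ι ι ℂ) v = ∑ i, ‖v i‖ ^ 2 := by
  simpa using acceptProb_diagonal (fun _ : ι ↦ True) v

theorem IsPureState.acceptProb_one [DecidableEq ι] {v : ι → ℂ} (hv : IsPureState v) :
    acceptProb (1 : Matrix ι ι ℂ) v = 1 :=
  (_root_.acceptProb_one v).trans hv

theorem acceptProb_conjTranspose_mul_mul (A : Matrix ι ι ℂ) (V : Matrix ι κ ℂ) (v : κ → ℂ) :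
    acceptProb (Vᴴ * A * V) v = acceptProb A (V *ᵥ v) := by
  rw [acceptProb, acceptProb, ← Matrix.mulVec_mulVec, ← Matrix.mulVec_mulVec,
    Matrix.dotProduct_mulVec _ Vᴴ, Matrix.star_mulVec]

theorem acceptProb_submatrix (A : Matrix ι ι ℂ) (e : κ ≃ ι) (v : κ → ℂ) :
    acceptProb (A.submatrix e e) v = acceptProb A (v ∘ e.symm) := by
  rw [acceptProb, acceptProb, Matrix.submatrix_mulVec_equiv]
  exact congrArg Complex.re <| Fintype.sum_equiv e _ _ fun i ↦ by simp

theorem star_dotProduct_mulVec_eq_acceptProb {A : Matrix ι ι ℂ} (hA : A.IsHermitian)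
    (v : ι → ℂ) : star v ⬝ᵥ (A *ᵥ v) = acceptProb A v :=
  Complex.ext rfl (hA.im_star_dotProduct_mulVec_self v)

theorem acceptProb_nonneg {A : Matrix ι ι ℂ} (hA : 0 ≤ A) (v : ι → ℂ) : 0 ≤ acceptProb A v :=
  (Complex.le_def.1 ((Matrix.nonneg_iff_posSemidef.1 hA).dotProduct_mulVec_nonneg v)).1

theorem acceptProb_mono {A B : Matrix ι ι ℂ} (h : A ≤ B) (v : ι → ℂ) :
    acceptProb A v ≤ acceptProb B v := by
  simpa only [acceptProb_sub, sub_nonneg] using acceptProb_nonneg (sub_nonneg.2 h) v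

theorem le_of_acceptProb_le {A B : Matrix ι ι ℂ} (hA : A.IsHermitian) (hB : B.IsHermitian)
    (h : ∀ v, acceptProb A v ≤ acceptProb B v) : A ≤ B := by
  have hBA := hB.sub hA
  refine Matrix.le_iff.2 <| .of_dotProduct_mulVec_nonneg hBA fun v ↦ Complex.le_def.2 ⟨?_, ?_⟩
  · exact (sub_nonneg.2 (h v)).trans_eq (acceptProb_sub B A v).symm
  · exact (hBA.im_star_dotProduct_mulVec_self v).symm

theorem sum_norm_sq_eq_zero_iff (v : ι → ℂ) : ∑ i, ‖v i‖ ^ 2 = 0 ↔ v = 0 := by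
  rw [Finset.sum_eq_zero_iff_of_nonneg fun i _ ↦ sq_nonneg _, funext_iff]
  simp

theorem acceptProb_le_mul_of_forall_isPureState {A : Matrix ι ι ℂ} {c : ℝ}
    (h : ∀ v, IsPureState v → acceptProb A v ≤ c) (v : ι → ℂ) :
    acceptProb A v ≤ c * ∑ i, ‖v i‖ ^ 2 := by
  set s := ∑ i, ‖v i‖ ^ 2 with hs
  have hs0 : 0 ≤ s := Finset.sum_nonneg fun i _ ↦ sq_nonneg _
  rcases hs0.eq_or_lt with hzero | hpos
  · simp [(sum_norm_sq_eq_zero_iff v).1 hzero.symm, acceptProb, ← hzero]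
  · have hsq : (√s)⁻¹ ^ 2 = s⁻¹ := by rw [inv_pow, Real.sq_sqrt hs0]
    have hpure : IsPureState ((((√s)⁻¹ : ℝ) : ℂ) • v) := by
      classical
      rw [IsPureState, ← acceptProb_one, acceptProb_smul_vec, acceptProb_one, hsq, ← hs,
        inv_mul_cancel₀ hpos.ne']
    simpa only [acceptProb_smul_vec, hsq, inv_mul_le_iff₀ hpos, mul_comm s] using h _ hpure

theorem le_smul_one_iff [DecidableEq ι] {A : Matrix ι ι ℂ} (hA : A.IsHermitian) {c : ℝ} :
    A ≤ c • 1 ↔ ∀ v, IsPureState v → acceptProb A v ≤ c := by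
  refine ⟨fun h v hv ↦ ?_, fun h ↦ le_of_acceptProb_le hA ?_ fun v ↦ ?_⟩
  · simpa only [acceptProb_smul, hv.acceptProb_one, mul_one] using acceptProb_mono h v
  · exact Matrix.isHermitian_one.smul (IsSelfAdjoint.all c)
  · rw [acceptProb_smul, acceptProb_one]
    exact acceptProb_le_mul_of_forall_isPureState h v

/-- This is `0 ≤ ⟨u - t⁻¹ v| A |u - t⁻¹ v⟩`, multiplied by `t`. -/
theorem le_acceptProb_vec_sub {A : Matrix ι ι ℂ} (hA : 0 ≤ A) {t : ℝ} (ht : 0 < t)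
    (u v : ι → ℂ) :
    (1 - t) * acceptProb A u + (1 - t⁻¹) * acceptProb A v ≤ acceptProb A (u - v) := by
  have hexpand (c : ℝ) : acceptProb A (u - (c : ℂ) • v) =
      acceptProb A u - c * ((star u ⬝ᵥ (A *ᵥ v)).re + (star v ⬝ᵥ (A *ᵥ u)).re)
        + c ^ 2 * acceptProb A v := by
    rw [← acceptProb_smul_vec]
    simp only [acceptProb, Matrix.mulVec_sub, Matrix.mulVec_smul, star_sub, star_smul,
      sub_dotProduct, dotProduct_sub, smul_dotProduct, dotProduct_smul, Complex.star_def,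
      Complex.conj_ofReal, smul_eq_mul, Complex.sub_re, Complex.re_ofReal_mul]
    ring
  have hnonneg := mul_nonneg ht.le (acceptProb_nonneg hA (u - (t⁻¹ : ℝ) • v))
  have hscaled := hexpand t⁻¹
  have hunscaled := hexpand 1
  rw [Complex.ofReal_one, one_smul] at hunscaled
  rw [Complex.coe_smul] at hscaled
  rw [hscaled] at hnonneg
  rw [hunscaled]
  field_simp at hnonneg ⊢
  linarith

theorem IsPureState.comp_equiv {v : ι → ℂ} (hv : IsPureState v) (e : κ ≃ ι) :
    IsPureState (v ∘ e) :=
  (Fintype.sum_equiv e _ _ fun _ ↦ rfl).trans hv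

end QuadraticForm

section Measurement

open scoped MatrixOrder Kronecker

variable {ι κ : Type*}

theorem one_kronecker_mono [Finite ι] [Finite κ] [DecidableEq κ] {A B : Matrix ι ι ℂ}
    (h : A ≤ B) : (1 : Matrix κ κ ℂ) ⊗ₖ A ≤ 1 ⊗ₖ B := by
  have hB : (1 : Matrix κ κ ℂ) ⊗ₖ B = 1 ⊗ₖ A + 1 ⊗ₖ (B - A) := by
    rw [← Matrix.kronecker_add, add_sub_cancel]
  rw [Matrix.le_iff, hB, add_sub_cancel_left]
  exact Matrix.PosSemidef.one.kronecker (Matrix.le_iff.1 h)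

variable [Fintype ι] [Fintype κ] [DecidableEq ι] [DecidableEq κ] {Γ E : Matrix ι ι ℂ}

theorem isMeasurementOperator_iff : IsMeasurementOperator Γ ↔ 0 ≤ Γ ∧ Γ ≤ 1 := by
  rw [Matrix.nonneg_iff_posSemidef, Matrix.le_iff, IsMeasurementOperator]

theorem isMeasurementOperator_one : IsMeasurementOperator (1 : Matrix ι ι ℂ) :=
  isMeasurementOperator_iff.2 ⟨zero_le_one, le_rfl⟩

theorem IsMeasurementOperator.nonneg (hΓ : IsMeasurementOperator Γ) : 0 ≤ Γ :=
  (isMeasurementOperator_iff.1 hΓ).1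

theorem IsMeasurementOperator.le_one (hΓ : IsMeasurementOperator Γ) : Γ ≤ 1 :=
  (isMeasurementOperator_iff.1 hΓ).2

theorem IsMeasurementOperator.isHermitian (hΓ : IsMeasurementOperator Γ) : Γ.IsHermitian :=
  hΓ.1.isHermitian

theorem IsMeasurementOperator.one_sub (hΓ : IsMeasurementOperator Γ) :
    IsMeasurementOperator (1 - Γ) :=
  isMeasurementOperator_iff.2 ⟨sub_nonneg.2 hΓ.le_one, sub_le_self _ hΓ.nonneg⟩

open scoped Matrix.Norms.L2Operator in
theorem IsMeasurementOperator.mul_self_le (hΓ : IsMeasurementOperator Γ) : Γ * Γ ≤ Γ := by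
  simpa only [sq, pow_one] using CStarAlgebra.pow_antitone hΓ.nonneg hΓ.le_one one_le_two

theorem IsMeasurementOperator.submatrix (hΓ : IsMeasurementOperator Γ) (e : κ ≃ ι) :
    IsMeasurementOperator (Γ.submatrix e e) :=
  isMeasurementOperator_iff.2 ⟨submatrix_mono hΓ.nonneg e,
    (submatrix_mono hΓ.le_one e).trans_eq (Matrix.submatrix_one_equiv e)⟩

theorem IsMeasurementOperator.conj (hΓ : IsMeasurementOperator Γ)
    (hE : IsMeasurementOperator E) : IsMeasurementOperator (Γ * E * Γ) := by
  refine isMeasurementOperator_iff.2 ⟨conjugate_nonneg_of_nonneg hE.nonneg hΓ.nonneg, ?_⟩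
  calc Γ * E * Γ ≤ Γ * 1 * Γ := conjugate_le_conjugate_of_nonneg hE.le_one hΓ.nonneg
    _ = Γ * Γ := by rw [mul_one]
    _ ≤ 1 := hΓ.mul_self_le.trans hΓ.le_one

theorem IsMeasurementOperator.one_kronecker (hΓ : IsMeasurementOperator Γ) :
    IsMeasurementOperator ((1 : Matrix κ κ ℂ) ⊗ₖ Γ) := by
  refine isMeasurementOperator_iff.2 ⟨?_, ?_⟩
  · simpa only [Matrix.kronecker_zero] using one_kronecker_mono (κ := κ) hΓ.nonneg
  · simpa only [Matrix.one_kronecker_one] using one_kronecker_mono (κ := κ) hΓ.le_one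

open scoped Matrix.Norms.L2Operator in
theorem isMeasurementOperator_saturate {Y : Matrix ι ι ℂ} (hY : 0 ≤ Y) :
    IsMeasurementOperator (saturate Y) :=
  isMeasurementOperator_iff.2 ⟨saturate_nonneg hY, saturate_le_one hY⟩

theorem IsMeasurementOperator.acceptProb_mulVec_le (hΓ : IsMeasurementOperator Γ)
    (v : ι → ℂ) : ∑ i, ‖(Γ *ᵥ v) i‖ ^ 2 ≤ acceptProb Γ v := by
  rw [← acceptProb_one, ← acceptProb_conjTranspose_mul_mul, hΓ.isHermitian.eq, mul_one]
  exact acceptProb_mono hΓ.mul_self_le v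

theorem IsMeasurementOperator.acceptProb_le_sum (hΓ : IsMeasurementOperator Γ) (v : ι → ℂ) :
    acceptProb Γ v ≤ ∑ i, ‖v i‖ ^ 2 :=
  (acceptProb_mono hΓ.le_one v).trans_eq (acceptProb_one v)

/-- The gentle measurement lemma, with `Γ` itself in place of the usual `√Γ`. -/
theorem IsMeasurementOperator.sub_two_mul_le_acceptProb_mulVec (hΓ : IsMeasurementOperator Γ)
    (hE : IsMeasurementOperator E) {v : ι → ℂ} (hv : IsPureState v) {b : ℝ} (hb : 0 < b)
    (h : 1 - acceptProb Γ v ≤ b ^ 2) :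
    acceptProb E v - 2 * b ≤ acceptProb E (Γ *ᵥ v) := by
  have hle : acceptProb E v ≤ 1 := (hE.acceptProb_le_sum v).trans_eq hv
  have hrest : acceptProb E ((1 - Γ) *ᵥ v) ≤ b ^ 2 := calc
    _ ≤ ∑ i, ‖((1 - Γ) *ᵥ v) i‖ ^ 2 := hE.acceptProb_le_sum _
    _ ≤ acceptProb (1 - Γ) v := hΓ.one_sub.acceptProb_mulVec_le v
    _ ≤ b ^ 2 := by rwa [acceptProb_sub, hv.acceptProb_one]
  have hrest_div : b⁻¹ * acceptProb E ((1 - Γ) *ᵥ v) ≤ b := by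
    rw [inv_mul_le_iff₀ hb, ← sq]
    exact hrest
  have hdecomp : v - (1 - Γ) *ᵥ v = Γ *ᵥ v := by
    rw [Matrix.sub_mulVec, Matrix.one_mulVec, sub_sub_cancel]
  have hsub := le_acceptProb_vec_sub hE.nonneg hb v ((1 - Γ) *ᵥ v)
  rw [hdecomp] at hsub
  nlinarith [acceptProb_nonneg hE.nonneg ((1 - Γ) *ᵥ v)]

end Measurement

section Contraction

open scoped MatrixOrder Kronecker

variable {α κ : Type*}

theorem IsPureState.tensorState [Fintype α] [Fintype κ] {ψ : α → ℂ} {φ : κ → ℂ}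
    (hψ : IsPureState ψ) (hφ : IsPureState φ) : IsPureState (tensorState ψ φ) := by
  unfold IsPureState at *
  simp only [_root_.tensorState, norm_mul, mul_pow, Fintype.sum_prod_type, ← Finset.mul_sum, hφ,
    mul_one, hψ]

/-- The isometric embedding `φ ↦ ψ ⊗ φ` (see `tensorLeft_mulVec`). -/
def tensorLeft (κ : Type*) [DecidableEq κ] (ψ : α → ℂ) : Matrix (α × κ) κ ℂ :=
  Matrix.of fun p k ↦ if p.2 = k then ψ p.1 else 0

variable [DecidableEq κ] [Fintype κ]

theorem tensorLeft_mulVec (ψ : α → ℂ) (φ : κ → ℂ) : tensorLeft κ ψ *ᵥ φ = tensorState ψ φ := by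
  funext p
  simp [tensorLeft, Matrix.mulVec, dotProduct, tensorState]

variable [Fintype α] {ψ : α → ℂ}

theorem conjTranspose_tensorLeft_mul_tensorLeft (hψ : IsPureState ψ) :
    (tensorLeft κ ψ)ᴴ * tensorLeft κ ψ = 1 := by
  ext k l
  have hcol (p : α × κ) : star (if p.2 = k then ψ p.1 else 0) * (if p.2 = l then ψ p.1 else 0) =
      ((‖ψ p.1‖ ^ 2 : ℝ) : ℂ) * (if p.2 = k then (1 : Matrix κ κ ℂ) k l else 0) := by
    rcases eq_or_ne p.2 k with rfl | hk
    · simp [Matrix.one_apply, Complex.conj_mul']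
    · simp [hk]
  simp only [Matrix.mul_apply, Matrix.conjTranspose_apply, tensorLeft, Matrix.of_apply, hcol,
    Fintype.sum_prod_type, ← Finset.mul_sum, ← Finset.sum_mul, Finset.sum_ite_eq',
    Finset.mem_univ, if_true, ← Complex.ofReal_sum]
  rw [hψ, Complex.ofReal_one, one_mul]

theorem one_kronecker_mul_tensorLeft [DecidableEq α] (A : Matrix κ κ ℂ) (ψ : α → ℂ) :
    ((1 : Matrix α α ℂ) ⊗ₖ A) * tensorLeft κ ψ = tensorLeft κ ψ * A := by
  ext ⟨a, k⟩ l
  simp [Matrix.mul_apply, tensorLeft, Fintype.sum_prod_type, Matrix.one_apply, mul_comm]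

variable {Γ Δ : Matrix (α × κ) (α × κ) ℂ}

/-- The measurement that `Γ` induces on the second register when the first one holds the state
`ψ`. -/
def inducedTest (Γ : Matrix (α × κ) (α × κ) ℂ) (ψ : α → ℂ) : Matrix κ κ ℂ :=
  (tensorLeft κ ψ)ᴴ * Γ * tensorLeft κ ψ

theorem acceptProb_inducedTest (Γ : Matrix (α × κ) (α × κ) ℂ) (ψ : α → ℂ) (φ : κ → ℂ) :
    acceptProb (inducedTest Γ ψ) φ = acceptProb Γ (tensorState ψ φ) := by
  rw [inducedTest, acceptProb_conjTranspose_mul_mul, tensorLeft_mulVec]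

theorem inducedTest_smul (c : ℝ) (Γ : Matrix (α × κ) (α × κ) ℂ) (ψ : α → ℂ) :
    inducedTest (c • Γ) ψ = c • inducedTest Γ ψ := by
  rw [inducedTest, inducedTest, Matrix.mul_smul, Matrix.smul_mul]

theorem inducedTest_nonneg (hΓ : 0 ≤ Γ) : 0 ≤ inducedTest Γ ψ :=
  Matrix.nonneg_iff_posSemidef.2 <|
    (Matrix.nonneg_iff_posSemidef.1 hΓ).conjTranspose_mul_mul_same _

theorem inducedTest_mono (h : Γ ≤ Δ) : inducedTest Γ ψ ≤ inducedTest Δ ψ := by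
  rw [← sub_nonneg, inducedTest, inducedTest, ← Matrix.sub_mul, ← Matrix.mul_sub]
  exact inducedTest_nonneg (sub_nonneg.2 h)

theorem inducedTest_le_smul_one_iff (hΓ : Γ.IsHermitian) {c : ℝ} :
    inducedTest Γ ψ ≤ c • 1 ↔
      ∀ φ, IsPureState φ → acceptProb Γ (tensorState ψ φ) ≤ c := by
  simp only [← acceptProb_inducedTest]
  exact le_smul_one_iff (Matrix.isHermitian_conjTranspose_mul_mul _ hΓ)

theorem inducedTest_one [DecidableEq α] (hψ : IsPureState ψ) :
    inducedTest (1 : Matrix (α × κ) (α × κ) ℂ) ψ = 1 := by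
  rw [inducedTest, Matrix.mul_one, conjTranspose_tensorLeft_mul_tensorLeft hψ]

theorem inducedTest_one_kronecker [DecidableEq α] (hψ : IsPureState ψ) (A : Matrix κ κ ℂ) :
    inducedTest ((1 : Matrix α α ℂ) ⊗ₖ A) ψ = A := by
  rw [inducedTest, Matrix.mul_assoc, one_kronecker_mul_tensorLeft, ← Matrix.mul_assoc,
    conjTranspose_tensorLeft_mul_tensorLeft hψ, Matrix.one_mul]

theorem inducedTest_one_add [DecidableEq α] (Γ : Matrix (α × κ) (α × κ) ℂ)
    (hψ : IsPureState ψ) : inducedTest (1 + Γ) ψ = 1 + inducedTest Γ ψ := by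
  rw [← inducedTest_one (κ := κ) hψ, inducedTest, inducedTest, inducedTest, Matrix.mul_add,
    Matrix.add_mul]

theorem IsMeasurementOperator.inducedTest [DecidableEq α] (hΓ : IsMeasurementOperator Γ)
    (hψ : IsPureState ψ) : IsMeasurementOperator (_root_.inducedTest Γ ψ) :=
  isMeasurementOperator_iff.2 ⟨inducedTest_nonneg hΓ.nonneg,
    (inducedTest_mono hΓ.le_one).trans_eq (inducedTest_one hψ)⟩

end Contraction

section PiKronecker

variable {ι : Type*} [Fintype ι] {l m n : ι → Type*}

/-- The tensor product of a finite family of matrices, with rows and columns indexed by choice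
functions. -/
def piKronecker (A : ∀ i, Matrix (m i) (n i) ℂ) : Matrix (∀ i, m i) (∀ i, n i) ℂ :=
  Matrix.of fun s t ↦ ∏ i, A i (s i) (t i)

/-- The product state `⨂ i, ψ i`. -/
def productState (ψ : ∀ i, m i → ℂ) : (∀ i, m i) → ℂ :=
  fun s ↦ ∏ i, ψ i (s i)

theorem conjTranspose_piKronecker (A : ∀ i, Matrix (m i) (n i) ℂ) :
    (piKronecker A)ᴴ = piKronecker fun i ↦ (A i)ᴴ := by
  ext s t
  simp only [piKronecker, Matrix.conjTranspose_apply, Matrix.of_apply, star_prod]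

theorem piKronecker_one [∀ i, DecidableEq (m i)] :
    piKronecker (fun i ↦ (1 : Matrix (m i) (m i) ℂ)) = 1 := by
  ext s t
  simp only [piKronecker, Matrix.of_apply, Matrix.one_apply, Finset.prod_ite_zero, funext_iff,
    Finset.mem_univ, forall_const, Finset.prod_const_one]

theorem piKronecker_smul (c : ℝ) (A : ∀ i, Matrix (m i) (n i) ℂ) :
    piKronecker (fun i ↦ c • A i) = c ^ Fintype.card ι • piKronecker A := by
  ext s t
  simp only [piKronecker, Matrix.of_apply, Matrix.smul_apply, Finset.prod_smul,
    Finset.prod_const, Finset.card_univ]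

/-- Sends an index for all the registers `α i` followed by all the `κ i` to the index for the pairs
of registers `(α i, κ i)`. -/
abbrev arrowProd (ι : Type*) (α κ : ι → Type*) :
    (∀ i, α i) × (∀ i, κ i) ≃ ∀ i, α i × κ i :=
  (Equiv.arrowProdEquivProdArrow ι α κ).symm

variable {κ : ι → Type*}

theorem tensorState_productState_comp_arrowProd (ψ : ∀ i, m i → ℂ) (φ : ∀ i, κ i → ℂ) :
    tensorState (productState ψ) (productState φ) ∘ (arrowProd ι m κ).symm =
      productState fun i ↦ tensorState (ψ i) (φ i) := by
  funext s
  exact Finset.prod_mul_distrib.symm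

variable [∀ i, DecidableEq (κ i)]

theorem tensorLeft_productState (ψ : ∀ i, m i → ℂ) :
    tensorLeft (∀ i, κ i) (productState ψ) =
      (piKronecker fun i ↦ tensorLeft (κ i) (ψ i)).submatrix (arrowProd ι m κ) id := by
  ext p k
  simp only [tensorLeft, piKronecker, productState, Matrix.of_apply, Matrix.submatrix_apply,
    Finset.prod_ite_zero, funext_iff, Finset.mem_univ, forall_const]
  rfl

variable [DecidableEq ι]

theorem piKronecker_add (A B : ∀ i, Matrix (m i) (n i) ℂ) :
    piKronecker (A + B) = ∑ S : Finset ι, piKronecker (S.piecewise A B) := by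
  ext s t
  simp only [piKronecker, Matrix.of_apply, Matrix.sum_apply, Pi.add_apply, Matrix.add_apply,
    Fintype.prod_add]
  refine Finset.sum_congr rfl fun S _ ↦ ?_
  rw [← Finset.prod_mul_prod_compl S]
  congr 1 <;> refine Finset.prod_congr rfl fun i hi ↦ ?_
  · rw [Finset.piecewise_eq_of_mem _ _ _ hi]
  · rw [Finset.piecewise_eq_of_notMem _ _ _ (Finset.mem_compl.1 hi)]

variable [∀ i, Fintype (m i)]

theorem piKronecker_mul_piKronecker (A : ∀ i, Matrix (l i) (m i) ℂ)
    (B : ∀ i, Matrix (m i) (n i) ℂ) :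
    piKronecker A * piKronecker B = piKronecker fun i ↦ A i * B i := by
  ext s t
  simp only [piKronecker, Matrix.mul_apply, Matrix.of_apply, Finset.prod_univ_sum,
    Fintype.piFinset_univ, Finset.prod_mul_distrib]

theorem piKronecker_mulVec_productState (A : ∀ i, Matrix (l i) (m i) ℂ) (ψ : ∀ i, m i → ℂ) :
    piKronecker A *ᵥ productState ψ = productState fun i ↦ A i *ᵥ ψ i := by
  funext s
  simp only [piKronecker, productState, Matrix.mulVec, dotProduct, Matrix.of_apply,
    Finset.prod_univ_sum, Fintype.piFinset_univ, Finset.prod_mul_distrib]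

theorem star_productState_dotProduct (ψ χ : ∀ i, m i → ℂ) :
    star (productState ψ) ⬝ᵥ productState χ = ∏ i, star (ψ i) ⬝ᵥ χ i := by
  simp only [productState, dotProduct, Pi.star_apply, star_prod,
    Finset.prod_univ_sum, Fintype.piFinset_univ, Finset.prod_mul_distrib]

theorem acceptProb_piKronecker {A : ∀ i, Matrix (m i) (m i) ℂ} (hA : ∀ i, (A i).IsHermitian)
    (ψ : ∀ i, m i → ℂ) :
    acceptProb (piKronecker A) (productState ψ) = ∏ i, acceptProb (A i) (ψ i) := by
  rw [acceptProb, piKronecker_mulVec_productState, star_productState_dotProduct]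
  simp only [star_dotProduct_mulVec_eq_acceptProb (hA _), ← Complex.ofReal_prod, Complex.ofReal_re]

theorem isPureState_productState {ψ : ∀ i, m i → ℂ} (hψ : ∀ i, IsPureState (ψ i)) :
    IsPureState (productState ψ) := by
  classical
  rw [IsPureState, ← acceptProb_one, ← piKronecker_one,
    acceptProb_piKronecker fun _ ↦ Matrix.isHermitian_one]
  exact Finset.prod_eq_one fun i _ ↦ (hψ i).acceptProb_one

theorem inducedTest_piKronecker [∀ i, Fintype (κ i)]
    (A : ∀ i, Matrix (m i × κ i) (m i × κ i) ℂ) (ψ : ∀ i, m i → ℂ) :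
    inducedTest ((piKronecker A).submatrix (arrowProd ι m κ) (arrowProd ι m κ)) (productState ψ) =
      piKronecker fun i ↦ inducedTest (A i) (ψ i) := by
  rw [inducedTest, tensorLeft_productState, Matrix.conjTranspose_submatrix,
    Matrix.submatrix_mul_equiv, Matrix.submatrix_mul_equiv, Matrix.submatrix_id_id,
    conjTranspose_piKronecker, piKronecker_mul_piKronecker, piKronecker_mul_piKronecker]
  rfl

end PiKronecker

section PiKroneckerOrder

open scoped MatrixOrder

variable {ι : Type*} [Fintype ι] {m : ι → Type*} [∀ i, Finite (m i)]
  {A B : ∀ i, Matrix (m i) (m i) ℂ}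

open scoped Matrix.Norms.L2Operator in
theorem piKronecker_nonneg (hA : ∀ i, 0 ≤ A i) : 0 ≤ piKronecker A := by
  classical
  have (i : ι) := Fintype.ofFinite (m i)
  choose B hB using fun i ↦ CStarAlgebra.nonneg_iff_eq_star_mul_self.1 (hA i)
  obtain rfl : A = fun i ↦ (B i)ᴴ * B i := funext hB
  rw [← piKronecker_mul_piKronecker, ← conjTranspose_piKronecker]
  exact star_mul_self_nonneg _

theorem piKronecker_mono (hA : ∀ i, 0 ≤ A i) (hAB : ∀ i, A i ≤ B i) :
    piKronecker A ≤ piKronecker B := by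
  classical
  have hpos (S : Finset ι) : 0 ≤ piKronecker (S.piecewise A (B - A)) :=
    piKronecker_nonneg fun i ↦ S.piecewise_cases A (B - A) (0 ≤ ·) (hA i) (sub_nonneg.2 (hAB i))
  calc piKronecker A = piKronecker (Finset.univ.piecewise A (B - A)) := by
        rw [Finset.piecewise_univ]
    _ ≤ ∑ S : Finset ι, piKronecker (S.piecewise A (B - A)) :=
        Finset.single_le_sum (fun S _ ↦ hpos S) (Finset.mem_univ _)
    _ = piKronecker B := by rw [← piKronecker_add, add_sub_cancel]

theorem smul_piKronecker_one_add_nonneg [∀ i, DecidableEq (m i)] {s : ℝ} (hs : 0 ≤ s)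
    (hA : ∀ i, 0 ≤ A i) : 0 ≤ s • piKronecker fun i ↦ 1 + A i := by
  classical
  have (i : ι) := Fintype.ofFinite (m i)
  exact smul_nonneg hs <| piKronecker_nonneg fun i ↦ add_nonneg zero_le_one (hA i)

end PiKroneckerOrder

section ParallelTest

open scoped MatrixOrder Matrix.Norms.L2Operator

variable {ι : Type*} [Fintype ι] [DecidableEq ι] {s : ℝ}

theorem one_sub_saturate_smul_piKronecker_le {m : ι → Type*} [∀ i, Fintype (m i)]
    [∀ i, DecidableEq (m i)] {A : ∀ i, Matrix (m i) (m i) ℂ} (hs : 0 < s) (hA : ∀ i, 0 ≤ A i) :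
    1 - saturate (s • piKronecker fun i ↦ 1 + A i) ≤
      s⁻¹ • piKronecker fun i ↦ 1 - saturate (A i) := by
  have hinv : (s • piKronecker fun i ↦ 1 + A i) * (s⁻¹ • piKronecker fun i ↦ 1 - saturate (A i)) =
      1 := by
    rw [Matrix.smul_mul, Matrix.mul_smul, smul_inv_smul₀ hs.ne', piKronecker_mul_piKronecker]
    simp only [one_add_mul_one_sub_saturate (hA _), piKronecker_one]
  exact one_sub_saturate_le_inv ⟨_, _, hinv, mul_eq_one_comm.1 hinv⟩
    (smul_piKronecker_one_add_nonneg hs.le hA)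

variable {α κ : Type*} [Fintype α] [Fintype κ] [DecidableEq α] [DecidableEq κ]
  {Γ : Matrix (α × κ) (α × κ) ℂ} {ψ : α → ℂ} {φ : κ → ℂ}

/-- A test on one pair of registers for each `i : ι`, which decides whether `Γ` would accept most
of the pairs. Where `j` of the pairs would be accepted with certainty and the others rejected, the
saturated operator is `s * 2 ^ j`, so that `s` places the threshold. -/
noncomputable def parallelTest (ι : Type*) [Fintype ι] [DecidableEq ι] (s : ℝ)
    (Γ : Matrix (α × κ) (α × κ) ℂ) : Matrix ((ι → α) × (ι → κ)) ((ι → α) × (ι → κ)) ℂ :=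
  (saturate (s • piKronecker fun _ : ι ↦ 1 + Γ)).submatrix
    (arrowProd ι (fun _ ↦ α) (fun _ ↦ κ)) (arrowProd ι (fun _ ↦ α) (fun _ ↦ κ))

theorem isMeasurementOperator_parallelTest (hs : 0 ≤ s) (hΓ : 0 ≤ Γ) :
    IsMeasurementOperator (parallelTest ι s Γ) :=
  (isMeasurementOperator_saturate (smul_piKronecker_one_add_nonneg hs fun _ ↦ hΓ)).submatrix _

theorem parallelTest_le (hs : 0 ≤ s) (hΓ : 0 ≤ Γ) :
    parallelTest ι s Γ ≤ s • (piKronecker fun _ : ι ↦ 1 + Γ).submatrix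
      (arrowProd ι (fun _ ↦ α) (fun _ ↦ κ)) (arrowProd ι (fun _ ↦ α) (fun _ ↦ κ)) := by
  have hle : saturate (s • piKronecker fun _ : ι ↦ 1 + Γ) ≤ s • piKronecker fun _ : ι ↦ 1 + Γ :=
    saturate_le_self (smul_piKronecker_one_add_nonneg hs fun _ ↦ hΓ)
  simpa only [parallelTest, Matrix.submatrix_smul, Pi.smul_apply] using
    submatrix_mono hle (arrowProd ι (fun _ ↦ α) (fun _ ↦ κ))

theorem inducedTest_parallelTest_le (hs : 0 ≤ s) (hΓ : 0 ≤ Γ) (hψ : IsPureState ψ) {p : ℝ}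
    (hp : inducedTest Γ ψ ≤ p • 1) :
    inducedTest (parallelTest ι s Γ) (productState fun _ ↦ ψ) ≤
      (s * (1 + p) ^ Fintype.card ι) • 1 := by
  have hone_add_nonneg : 0 ≤ inducedTest (1 + Γ) ψ :=
    inducedTest_nonneg (add_nonneg zero_le_one hΓ)
  have hone_add_le : inducedTest (1 + Γ) ψ ≤ (1 + p) • 1 := by
    rw [inducedTest_one_add Γ hψ, add_smul, one_smul]
    exact add_le_add_right hp 1
  calc inducedTest (parallelTest ι s Γ) (productState fun _ ↦ ψ)
      ≤ inducedTest (s • (piKronecker fun _ : ι ↦ 1 + Γ).submatrix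
          (arrowProd ι (fun _ ↦ α) (fun _ ↦ κ)) (arrowProd ι (fun _ ↦ α) (fun _ ↦ κ)))
          (productState fun _ ↦ ψ) :=
        inducedTest_mono (parallelTest_le hs hΓ)
    _ = s • piKronecker fun _ : ι ↦ inducedTest (1 + Γ) ψ := by
        rw [inducedTest_smul, inducedTest_piKronecker]
    _ ≤ s • piKronecker fun _ : ι ↦ (1 + p) • (1 : Matrix κ κ ℂ) :=
        smul_le_smul_of_nonneg_left
          (piKronecker_mono (fun _ ↦ hone_add_nonneg) fun _ ↦ hone_add_le) hs
    _ = (s * (1 + p) ^ Fintype.card ι) • 1 := by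
        rw [piKronecker_smul, piKronecker_one, smul_smul]

theorem acceptProb_one_sub_saturate_le (hΓ : IsMeasurementOperator Γ) {v : α × κ → ℂ}
    (hv : IsPureState v) : acceptProb (1 - saturate Γ) v ≤ 1 - acceptProb Γ v / 2 := by
  have hhalf := acceptProb_mono
    (smul_le_saturate zero_le_one hΓ.nonneg hΓ.le_one (one_smul ℝ Γ).le) v
  rw [acceptProb_smul] at hhalf
  rw [acceptProb_sub, hv.acceptProb_one]
  linarith

theorem one_sub_acceptProb_parallelTest_le (hs : 0 < s) (hΓ : IsMeasurementOperator Γ)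
    (hψ : IsPureState ψ) (hφ : IsPureState φ) {q : ℝ} (hq : q ≤ acceptProb Γ (tensorState ψ φ)) :
    1 - acceptProb (parallelTest ι s Γ)
        (tensorState (productState fun _ ↦ ψ) (productState fun _ ↦ φ)) ≤
      s⁻¹ * (1 - q / 2) ^ Fintype.card ι := by
  set v := tensorState ψ φ
  have hv : IsPureState v := hψ.tensorState hφ
  have hv' : IsPureState (productState fun _ : ι ↦ v) := isPureState_productState fun _ ↦ hv
  have hcompl : IsMeasurementOperator (1 - saturate Γ) :=
    (isMeasurementOperator_saturate hΓ.nonneg).one_sub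
  rw [parallelTest, acceptProb_submatrix, tensorState_productState_comp_arrowProd]
  calc 1 - acceptProb (saturate (s • piKronecker fun _ : ι ↦ 1 + Γ)) (productState fun _ ↦ v)
      = acceptProb (1 - saturate (s • piKronecker fun _ : ι ↦ 1 + Γ)) (productState fun _ ↦ v) := by
        rw [acceptProb_sub, hv'.acceptProb_one]
    _ ≤ acceptProb (s⁻¹ • piKronecker fun _ : ι ↦ 1 - saturate Γ) (productState fun _ ↦ v) :=
        acceptProb_mono (one_sub_saturate_smul_piKronecker_le hs fun _ ↦ hΓ.nonneg) _
    _ = s⁻¹ * acceptProb (1 - saturate Γ) v ^ Fintype.card ι := by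
        rw [acceptProb_smul, acceptProb_piKronecker fun _ ↦ hcompl.isHermitian, Finset.prod_const,
          Finset.card_univ]
    _ ≤ s⁻¹ * (1 - q / 2) ^ Fintype.card ι := by
        have hreject := acceptProb_one_sub_saturate_le hΓ hv
        have hnonneg := acceptProb_nonneg hcompl.nonneg v
        gcongr
        linarith

end ParallelTest

section SequentialTest

open scoped MatrixOrder Kronecker

variable {α β κ : Type*}

theorem kronecker_mulVec_tensorState {α' κ' : Type*} [Fintype α] [Fintype κ]
    (A : Matrix α' α ℂ) (B : Matrix κ' κ ℂ) (ψ : α → ℂ) (φ : κ → ℂ) :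
    (A ⊗ₖ B) *ᵥ tensorState ψ φ = tensorState (A *ᵥ ψ) (B *ᵥ φ) := by
  funext p
  simp only [Matrix.mulVec, dotProduct, tensorState, Matrix.kroneckerMap_apply,
    Fintype.sum_prod_type, Finset.sum_mul_sum, mul_mul_mul_comm]

/-- Moves the second of three registers to the front. -/
abbrev swapFirstTwo (α β κ : Type*) : α × β × κ ≃ β × α × κ :=
  (Equiv.prodAssoc α β κ).symm.trans <|
    ((Equiv.prodComm α β).prodCongr (Equiv.refl κ)).trans (Equiv.prodAssoc β α κ)

theorem one_kronecker_tensorLeft [DecidableEq α] [DecidableEq κ] (χ : β → ℂ) :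
    (1 : Matrix α α ℂ) ⊗ₖ tensorLeft κ χ =
      (tensorLeft (α × κ) χ).submatrix (swapFirstTwo α β κ) id := by
  ext ⟨a, b, k⟩ ⟨a', k'⟩
  simp [tensorLeft, Matrix.one_apply, ← ite_and, and_comm]

variable [Fintype α] [Fintype β] [Fintype κ] [DecidableEq α] [DecidableEq β] [DecidableEq κ]
  {Γ : Matrix (α × κ) (α × κ) ℂ} {E : Matrix (β × κ) (β × κ) ℂ} {ψ : α → ℂ} {χ : β → ℂ}
  {φ : κ → ℂ} {p q b : ℝ}

/-- The test `Γ` followed by the test `E`, where the two act on different messages but on the same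
witness register. The witness left behind by an accepting `Γ` should be given by `√Γ`; using `Γ`
itself is also sound because `Γ * Γ ≤ Γ`. -/
noncomputable def thenTest (Γ : Matrix (α × κ) (α × κ) ℂ) (E : Matrix (β × κ) (β × κ) ℂ) :
    Matrix ((α × β) × κ) ((α × β) × κ) ℂ :=
  (((1 : Matrix β β ℂ) ⊗ₖ Γ).submatrix (swapFirstTwo α β κ) (swapFirstTwo α β κ) *
    ((1 : Matrix α α ℂ) ⊗ₖ E) *
    ((1 : Matrix β β ℂ) ⊗ₖ Γ).submatrix (swapFirstTwo α β κ) (swapFirstTwo α β κ)).submatrix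
      (Equiv.prodAssoc α β κ) (Equiv.prodAssoc α β κ)

theorem isMeasurementOperator_thenTest (hΓ : IsMeasurementOperator Γ)
    (hE : IsMeasurementOperator E) : IsMeasurementOperator (thenTest Γ E) :=
  ((hΓ.one_kronecker.submatrix _).conj hE.one_kronecker).submatrix _

theorem acceptProb_thenTest (hΓ : Γ.IsHermitian) :
    acceptProb (thenTest Γ E) (tensorState (tensorState ψ χ) φ) =
      acceptProb ((1 : Matrix α α ℂ) ⊗ₖ inducedTest E χ) (Γ *ᵥ tensorState ψ φ) := by
  set G := ((1 : Matrix β β ℂ) ⊗ₖ Γ).submatrix (swapFirstTwo α β κ) (swapFirstTwo α β κ) with hG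
  set V := (1 : Matrix α α ℂ) ⊗ₖ tensorLeft κ χ with hV
  have hGherm : G = Gᴴ := by
    rw [hG, Matrix.conjTranspose_submatrix, Matrix.conjTranspose_kronecker,
      Matrix.conjTranspose_one, hΓ.eq]
  have hstate : tensorState (tensorState ψ χ) φ ∘ (Equiv.prodAssoc α β κ).symm =
      V *ᵥ tensorState ψ φ := by
    rw [hV, kronecker_mulVec_tensorState, Matrix.one_mulVec, tensorLeft_mulVec]
    exact funext fun _ ↦ mul_assoc _ _ _
  have hGV : G * V = V * Γ := by
    rw [hG, hV, one_kronecker_tensorLeft, Matrix.submatrix_mul_equiv,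
      one_kronecker_mul_tensorLeft, ← Matrix.submatrix_mul_equiv _ _ _ (Equiv.refl _)]
    rfl
  have hVEV : Vᴴ * ((1 : Matrix α α ℂ) ⊗ₖ E) * V = (1 : Matrix α α ℂ) ⊗ₖ inducedTest E χ := by
    rw [hV, Matrix.conjTranspose_kronecker, ← Matrix.mul_kronecker_mul,
      ← Matrix.mul_kronecker_mul, Matrix.conjTranspose_one, one_mul, one_mul, inducedTest]
  rw [thenTest, acceptProb_submatrix, hstate, ← hG]
  nth_rw 1 [hGherm]
  rw [acceptProb_conjTranspose_mul_mul, Matrix.mulVec_mulVec, hGV, ← Matrix.mulVec_mulVec,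
    ← acceptProb_conjTranspose_mul_mul, hVEV]

theorem inducedTest_thenTest_le (hΓ : IsMeasurementOperator Γ) (hE : IsMeasurementOperator E)
    (hp : inducedTest Γ ψ ≤ p • 1) (hq0 : 0 ≤ q) (hq : inducedTest E χ ≤ q • 1) :
    inducedTest (thenTest Γ E) (tensorState ψ χ) ≤ (p * q) • 1 := by
  have hΓE := isMeasurementOperator_thenTest hΓ hE
  have hkron : (1 : Matrix α α ℂ) ⊗ₖ inducedTest E χ ≤ q • 1 := by
    simpa only [Matrix.kronecker_smul, Matrix.one_kronecker_one] using
      one_kronecker_mono (κ := α) hq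
  refine (inducedTest_le_smul_one_iff hΓE.isHermitian).2 fun φ hφ ↦ ?_
  calc acceptProb (thenTest Γ E) (tensorState (tensorState ψ χ) φ)
      = acceptProb ((1 : Matrix α α ℂ) ⊗ₖ inducedTest E χ) (Γ *ᵥ tensorState ψ φ) :=
        acceptProb_thenTest hΓ.isHermitian
    _ ≤ q * ∑ i, ‖(Γ *ᵥ tensorState ψ φ) i‖ ^ 2 := by
        rw [← acceptProb_one, ← acceptProb_smul]
        exact acceptProb_mono hkron _
    _ ≤ q * acceptProb Γ (tensorState ψ φ) :=
        mul_le_mul_of_nonneg_left (hΓ.acceptProb_mulVec_le _) hq0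
    _ ≤ p * q := by
        rw [mul_comm p]
        exact mul_le_mul_of_nonneg_left
          ((inducedTest_le_smul_one_iff hΓ.isHermitian).1 hp φ hφ) hq0

theorem sub_two_mul_le_acceptProb_thenTest (hΓ : IsMeasurementOperator Γ)
    (hE : IsMeasurementOperator E) (hψ : IsPureState ψ) (hχ : IsPureState χ) (hφ : IsPureState φ)
    (hb : 0 < b) (h : 1 - acceptProb Γ (tensorState ψ φ) ≤ b ^ 2) :
    acceptProb E (tensorState χ φ) - 2 * b ≤
      acceptProb (thenTest Γ E) (tensorState (tensorState ψ χ) φ) := by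
  have hkron : IsMeasurementOperator ((1 : Matrix α α ℂ) ⊗ₖ inducedTest E χ) :=
    (hE.inducedTest hχ).one_kronecker
  rw [acceptProb_thenTest hΓ.isHermitian]
  convert hΓ.sub_two_mul_le_acceptProb_mulVec hkron (hψ.tensorState hφ) hb h using 2
  rw [← acceptProb_inducedTest, ← acceptProb_inducedTest, inducedTest_one_kronecker hψ]

/-- The test `Γ` performed on `r` messages in succession, all with the same witness register. -/
noncomputable def repeatTest (Γ : Matrix (α × κ) (α × κ) ℂ) :
    ∀ r : ℕ, Matrix ((Fin r → α) × κ) ((Fin r → α) × κ) ℂ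
  | 0 => 1
  | r + 1 => (thenTest Γ (repeatTest Γ r)).submatrix
      ((Fin.consEquiv fun _ ↦ α).symm.prodCongr (Equiv.refl κ))
      ((Fin.consEquiv fun _ ↦ α).symm.prodCongr (Equiv.refl κ))

theorem isMeasurementOperator_repeatTest (hΓ : IsMeasurementOperator Γ) :
    ∀ r, IsMeasurementOperator (repeatTest Γ r)
  | 0 => isMeasurementOperator_one
  | r + 1 => (isMeasurementOperator_thenTest hΓ (isMeasurementOperator_repeatTest hΓ r)).submatrix _

theorem inducedTest_repeatTest_succ (r : ℕ) :
    inducedTest (repeatTest Γ (r + 1)) (productState fun _ ↦ ψ) =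
      inducedTest (thenTest Γ (repeatTest Γ r)) (tensorState ψ (productState fun _ ↦ ψ)) := by
  have hstate : tensorLeft κ (productState fun _ : Fin (r + 1) ↦ ψ) =
      (tensorLeft κ (tensorState ψ (productState fun _ : Fin r ↦ ψ))).submatrix
        ((Fin.consEquiv fun _ ↦ α).symm.prodCongr (Equiv.refl κ)) id := by
    ext p k
    simp [tensorLeft, productState, tensorState, Fin.prod_univ_succ, Fin.consEquiv, Fin.tail]
  rw [inducedTest, repeatTest, hstate, Matrix.conjTranspose_submatrix,
    Matrix.submatrix_mul_equiv, Matrix.submatrix_mul_equiv, Matrix.submatrix_id_id, inducedTest]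

theorem inducedTest_repeatTest_le (hΓ : IsMeasurementOperator Γ) (hψ : IsPureState ψ)
    (hp0 : 0 ≤ p) (hp : inducedTest Γ ψ ≤ p • 1) (r : ℕ) :
    inducedTest (repeatTest Γ r) (productState fun _ ↦ ψ) ≤ p ^ r • 1 := by
  induction r with
  | zero =>
    rw [repeatTest, inducedTest_one (isPureState_productState fun _ ↦ hψ), pow_zero, one_smul]
  | succ r ih =>
    rw [inducedTest_repeatTest_succ, pow_succ']
    exact inducedTest_thenTest_le hΓ (isMeasurementOperator_repeatTest hΓ r) hp
      (pow_nonneg hp0 r) ih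

theorem one_sub_acceptProb_repeatTest_le (hΓ : IsMeasurementOperator Γ) (hψ : IsPureState ψ)
    (hφ : IsPureState φ) (hb : 0 < b) (h : 1 - acceptProb Γ (tensorState ψ φ) ≤ b ^ 2) (r : ℕ) :
    1 - acceptProb (repeatTest Γ r) (tensorState (productState fun _ ↦ ψ) φ) ≤ 2 * b * r := by
  have hψr (r : ℕ) : IsPureState (productState fun _ : Fin r ↦ ψ) :=
    isPureState_productState fun _ ↦ hψ
  induction r with
  | zero => simp [repeatTest, ((hψr 0).tensorState hφ).acceptProb_one]
  | succ r ih =>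
    have hstep := sub_two_mul_le_acceptProb_thenTest hΓ (isMeasurementOperator_repeatTest hΓ r)
      hψ (hψr r) hφ hb h
    rw [← acceptProb_inducedTest, inducedTest_repeatTest_succ, acceptProb_inducedTest]
    push_cast
    linarith

end SequentialTest

section WitnessRemoval

open scoped MatrixOrder Matrix.Norms.L2Operator

variable {α κ : Type*}

/-- The partial trace of a test over its second register. -/
def partialTrace [Fintype κ] (E : Matrix (α × κ) (α × κ) ℂ) : Matrix α α ℂ :=
  ∑ k, E.submatrix (fun a ↦ (a, k)) (fun a ↦ (a, k))

variable [Fintype κ] {E : Matrix (α × κ) (α × κ) ℂ} {ψ : α → ℂ} {φ : κ → ℂ}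

theorem partialTrace_nonneg (hE : 0 ≤ E) : 0 ≤ partialTrace E :=
  Finset.sum_nonneg fun _ _ ↦ submatrix_mono hE _

theorem re_trace_mono {A B : Matrix κ κ ℂ} (h : A ≤ B) : A.trace.re ≤ B.trace.re := by
  rw [← sub_nonneg, ← Complex.sub_re, ← Matrix.trace_sub]
  exact (Complex.le_def.1 (Matrix.le_iff.1 h).trace_nonneg).1

variable [Fintype α] {t : ℝ}

/-- A test on the message alone that replaces `E`: it accepts a message if some witness makes `E`
accept with a good probability, and rejects it if all witnesses make `E` accept with a probability
far below `1 / (t * Fintype.card κ)`. -/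
noncomputable def witnessFreeTest [DecidableEq α] (t : ℝ) (E : Matrix (α × κ) (α × κ) ℂ) :
    Matrix α α ℂ :=
  saturate (t • partialTrace E)

theorem isMeasurementOperator_witnessFreeTest [DecidableEq α] (ht : 0 ≤ t) (hE : 0 ≤ E) :
    IsMeasurementOperator (witnessFreeTest t E) :=
  isMeasurementOperator_saturate (smul_nonneg ht (partialTrace_nonneg hE))

theorem acceptProb_inducedTest_submatrix_prodComm [DecidableEq α]
    (E : Matrix (α × κ) (α × κ) ℂ) (ψ : α → ℂ) (φ : κ → ℂ) :
    acceptProb (inducedTest (E.submatrix (Equiv.prodComm κ α) (Equiv.prodComm κ α)) φ) ψ =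
      acceptProb E (tensorState ψ φ) := by
  rw [acceptProb_inducedTest, acceptProb_submatrix]
  exact congrArg _ (funext fun _ ↦ mul_comm _ _)

theorem le_re_trace_smul_one [DecidableEq κ] {A : Matrix κ κ ℂ} (hA : 0 ≤ A) :
    A ≤ A.trace.re • 1 := by
  have hpos := Matrix.nonneg_iff_posSemidef.1 hA
  rw [← Algebra.algebraMap_eq_smul_one, le_algebraMap_iff_spectrum_le]
  intro x hx
  rw [hpos.isHermitian.spectrum_real_eq_range_eigenvalues] at hx
  obtain ⟨k, rfl⟩ := hx
  have hsum : A.trace.re = ∑ i, hpos.isHermitian.eigenvalues i := by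
    rw [hpos.isHermitian.trace_eq_sum_eigenvalues, Complex.re_sum]
    rfl
  rw [hsum]
  exact Finset.single_le_sum (fun i _ ↦ hpos.eigenvalues_nonneg i) (Finset.mem_univ k)

theorem acceptProb_partialTrace [DecidableEq κ] (E : Matrix (α × κ) (α × κ) ℂ) (ψ : α → ℂ) :
    acceptProb (partialTrace E) ψ = (inducedTest E ψ).trace.re := by
  rw [acceptProb, partialTrace, Matrix.sum_mulVec, dotProduct_sum, Matrix.trace]
  refine congrArg Complex.re (Finset.sum_congr rfl fun k _ ↦ ?_)
  simp only [inducedTest, tensorLeft, Matrix.diag_apply, Matrix.mul_apply, Matrix.mulVec,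
    dotProduct, Matrix.conjTranspose_apply, Matrix.of_apply, Matrix.submatrix_apply,
    Fintype.sum_prod_type, apply_ite star, star_zero, ite_mul, zero_mul, mul_ite, mul_zero,
    Finset.sum_ite_eq', Finset.mem_univ, if_true, Finset.mul_sum, Finset.sum_mul, Pi.star_apply,
    mul_assoc]
  exact Finset.sum_comm

theorem acceptProb_le_acceptProb_partialTrace (hE : 0 ≤ E) (ψ : α → ℂ) (hφ : IsPureState φ) :
    acceptProb E (tensorState ψ φ) ≤ acceptProb (partialTrace E) ψ := by
  classical
  have hind := inducedTest_nonneg (ψ := ψ) hE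
  rw [acceptProb_partialTrace, ← acceptProb_inducedTest]
  exact (le_smul_one_iff (Matrix.nonneg_iff_posSemidef.1 hind).isHermitian).1
    (le_re_trace_smul_one hind) φ hφ

theorem inducedTest_submatrix_prodComm_le_partialTrace [DecidableEq α] (hE : 0 ≤ E)
    (hφ : IsPureState φ) :
    inducedTest (E.submatrix (Equiv.prodComm κ α) (Equiv.prodComm κ α)) φ ≤ partialTrace E := by
  have hcomm : 0 ≤ E.submatrix (Equiv.prodComm κ α) (Equiv.prodComm κ α) := submatrix_mono hE _
  refine le_of_acceptProb_le
    (Matrix.nonneg_iff_posSemidef.1 (inducedTest_nonneg hcomm)).isHermitian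
    (Matrix.nonneg_iff_posSemidef.1 (partialTrace_nonneg hE)).isHermitian fun ψ ↦ ?_
  rw [acceptProb_inducedTest_submatrix_prodComm]
  exact acceptProb_le_acceptProb_partialTrace hE ψ hφ

variable [DecidableEq κ]

theorem acceptProb_partialTrace_le {d : ℝ} (hd : inducedTest E ψ ≤ d • 1) :
    acceptProb (partialTrace E) ψ ≤ Fintype.card κ * d := by
  rw [acceptProb_partialTrace]
  refine (re_trace_mono hd).trans_eq ?_
  simp [Matrix.trace_smul, mul_comm]

variable [DecidableEq α]

theorem acceptProb_witnessFreeTest_le (ht : 0 ≤ t) (hE : 0 ≤ E) {d : ℝ}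
    (hd : inducedTest E ψ ≤ d • 1) :
    acceptProb (witnessFreeTest t E) ψ ≤ t * (Fintype.card κ * d) := by
  have hle : witnessFreeTest t E ≤ t • partialTrace E :=
    saturate_le_self (smul_nonneg ht (partialTrace_nonneg hE))
  calc acceptProb (witnessFreeTest t E) ψ ≤ t * acceptProb (partialTrace E) ψ :=
        (acceptProb_mono hle ψ).trans_eq (acceptProb_smul _ _ _)
    _ ≤ t * (Fintype.card κ * d) := mul_le_mul_of_nonneg_left (acceptProb_partialTrace_le hd) ht

theorem mul_acceptProb_le_acceptProb_witnessFreeTest (ht : 0 ≤ t) (hE : IsMeasurementOperator E)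
    (ψ : α → ℂ) (hφ : IsPureState φ) :
    t / (1 + t) * acceptProb E (tensorState ψ φ) ≤ acceptProb (witnessFreeTest t E) ψ := by
  set Q := inducedTest (E.submatrix (Equiv.prodComm κ α) (Equiv.prodComm κ α)) φ with hQdef
  have hQ : IsMeasurementOperator Q := (hE.submatrix _).inducedTest hφ
  have hle : t • Q ≤ t • partialTrace E := smul_le_smul_of_nonneg_left
    (inducedTest_submatrix_prodComm_le_partialTrace hE.nonneg hφ) ht
  have hsat : (t / (1 + t)) • Q ≤ witnessFreeTest t E := smul_le_saturate ht hQ.nonneg hQ.le_one hle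
  rw [← acceptProb_inducedTest_submatrix_prodComm, ← hQdef, ← acceptProb_smul]
  exact acceptProb_mono hsat ψ

end WitnessRemoval

section Assembly

open scoped MatrixOrder

variable {α κ : Type*} [Fintype α] [Fintype κ] [DecidableEq α] [DecidableEq κ]
  {Γ : Matrix (α × κ) (α × κ) ℂ} {ψ : α → ℂ} {φ : κ → ℂ}

/-- The test on `2 * k * r` messages that replaces `Γ`: a group of `2 * k` pairs of registers is
tested in parallel, this is repeated on `r` groups of messages with the same group of witnesses,
and finally the witnesses are removed. At the threshold `s = 2⁻ᵏ`, the
error bounds `s * (1 + p) ^ (2 * k)` and `s⁻¹ * (1 - q / 2) ^ (2 * k)` of the parallel test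
at `p = 1 / 3` and `q = 2 / 3` are both equal to `(8 / 9) ^ k`. -/
noncomputable def merlinFreeTest (k r : ℕ) (Γ : Matrix (α × κ) (α × κ) ℂ) :
    Matrix (Fin r → Fin (2 * k) → α) (Fin r → Fin (2 * k) → α) ℂ :=
  witnessFreeTest 4 (repeatTest (parallelTest (Fin (2 * k)) (2 ^ k)⁻¹ Γ) r)

theorem isMeasurementOperator_repeatTest_parallelTest (k r : ℕ) (hΓ : 0 ≤ Γ) :
    IsMeasurementOperator (repeatTest (parallelTest (Fin (2 * k)) (2 ^ k)⁻¹ Γ) r) :=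
  isMeasurementOperator_repeatTest (isMeasurementOperator_parallelTest (by positivity) hΓ) r

theorem isMeasurementOperator_merlinFreeTest (k r : ℕ) (hΓ : 0 ≤ Γ) :
    IsMeasurementOperator (merlinFreeTest k r Γ) :=
  isMeasurementOperator_witnessFreeTest (by norm_num)
    (isMeasurementOperator_repeatTest_parallelTest k r hΓ).nonneg

theorem acceptProb_merlinFreeTest_le (k r : ℕ) (hΓ : IsMeasurementOperator Γ)
    (hψ : IsPureState ψ)
    (h : ∀ φ, IsPureState φ → acceptProb Γ (tensorState ψ φ) ≤ 1 / 3) :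
    acceptProb (merlinFreeTest k r Γ) (productState fun _ ↦ productState fun _ ↦ ψ) ≤
      4 * ((Fintype.card κ : ℝ) ^ (2 * k) * ((8 / 9) ^ k) ^ r) := by
  have hΓψ : inducedTest Γ ψ ≤ (1 / 3 : ℝ) • 1 :=
    (inducedTest_le_smul_one_iff hΓ.isHermitian).2 h
  have hparallel : inducedTest (parallelTest (Fin (2 * k)) (2 ^ k)⁻¹ Γ) (productState fun _ ↦ ψ) ≤
      ((8 / 9 : ℝ) ^ k) • 1 := by
    convert inducedTest_parallelTest_le (s := (2 ^ k)⁻¹) (by positivity) hΓ.nonneg hψ hΓψ using 2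
    rw [Fintype.card_fin, pow_mul, ← inv_pow, ← mul_pow]
    norm_num
  have hrepeat := inducedTest_repeatTest_le
    (isMeasurementOperator_parallelTest (by positivity) hΓ.nonneg)
    (isPureState_productState fun _ ↦ hψ) (by positivity) hparallel r
  simpa only [merlinFreeTest, Fintype.card_fun, Fintype.card_fin, Nat.cast_pow] using
    acceptProb_witnessFreeTest_le (by norm_num : (0 : ℝ) ≤ 4)
      (isMeasurementOperator_repeatTest_parallelTest k r hΓ.nonneg).nonneg hrepeat

theorem two_thirds_le_acceptProb_merlinFreeTest {k r : ℕ} (hr : 0 < r)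
    (hkr : (8 / 9 : ℝ) ^ k ≤ (1 / (12 * r)) ^ 2) (hΓ : IsMeasurementOperator Γ)
    (hψ : IsPureState ψ) (hφ : IsPureState φ) (h : 2 / 3 ≤ acceptProb Γ (tensorState ψ φ)) :
    2 / 3 ≤ acceptProb (merlinFreeTest k r Γ)
      (productState fun _ ↦ productState fun _ ↦ ψ) := by
  have hψs : IsPureState (productState fun _ : Fin (2 * k) ↦ ψ) :=
    isPureState_productState fun _ ↦ hψ
  have hφs : IsPureState (productState fun _ : Fin (2 * k) ↦ φ) :=
    isPureState_productState fun _ ↦ hφ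
  have hparallel : 1 - acceptProb (parallelTest (Fin (2 * k)) (2 ^ k)⁻¹ Γ)
      (tensorState (productState fun _ ↦ ψ) (productState fun _ ↦ φ)) ≤ (1 / (12 * r)) ^ 2 := by
    refine (one_sub_acceptProb_parallelTest_le (by positivity) hΓ hψ hφ h).trans (le_trans ?_ hkr)
    rw [Fintype.card_fin, pow_mul, inv_inv, ← mul_pow]
    norm_num
  have hrepeat := one_sub_acceptProb_repeatTest_le
    (isMeasurementOperator_parallelTest (by positivity) hΓ.nonneg) hψs hφs (by positivity)
    hparallel r
  have hloss : 2 * (1 / (12 * r)) * r = (1 / 6 : ℝ) := by field_simp; norm_num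
  have hremove := mul_acceptProb_le_acceptProb_witnessFreeTest (by norm_num : (0 : ℝ) ≤ 4)
    (isMeasurementOperator_repeatTest_parallelTest k r hΓ.nonneg)
    (productState fun _ ↦ productState fun _ ↦ ψ) hφs
  rw [merlinFreeTest]
  -- The repetition leaves `1 - 1/6`, and removing the witnesses `4/5` of that.
  linarith

variable {n m a w : ℕ} {f : PartialBoolFun n m}

theorem Q1_le_of_card_eq (hcard : Fintype.card α = 2 ^ a) {message : Bits n → α → ℂ}
    (hmessage : ∀ x, IsPureState (message x)) {measure : Bits m → Matrix α α ℂ}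
    (hmeasure : ∀ y, IsMeasurementOperator (measure y))
    (htrue : ∀ x y, f x y = some true → 2 / 3 ≤ acceptProb (measure y) (message x))
    (hfalse : ∀ x y, f x y = some false → acceptProb (measure y) (message x) ≤ 1 / 3) :
    Q1 f ≤ a := by
  have e : Bits a ≃ α := Fintype.equivOfCardEq (by simp [hcard])
  refine Nat.sInf_le ⟨⟨fun x ↦ message x ∘ e, fun x ↦ (hmessage x).comp_equiv e,
    fun y ↦ (measure y).submatrix e e, fun y ↦ (hmeasure y).submatrix e⟩, fun x y ↦ ?_⟩
  simp only [acceptProb_submatrix, Function.comp_assoc, Equiv.self_comp_symm, Function.comp_id]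
  exact ⟨htrue x y, fun hxy ↦ by linarith [hfalse x y hxy]⟩

theorem MerlinProtocol.Verifies.Q1_le {P : MerlinProtocol n m a w} (hP : P.Verifies f) {k r : ℕ}
    (hr : 0 < r) (hcomplete : (8 / 9 : ℝ) ^ k ≤ (1 / (12 * r)) ^ 2)
    (hsound : 4 * (((2 : ℝ) ^ w) ^ (2 * k) * ((8 / 9) ^ k) ^ r) ≤ 1 / 3) :
    Q1 f ≤ a * (2 * k) * r := by
  refine Q1_le_of_card_eq (α := Fin r → Fin (2 * k) → Bits a) (by simp [pow_mul])
    (fun x ↦ isPureState_productState fun _ ↦ isPureState_productState fun _ ↦ P.message_pure x)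
    (fun y ↦ isMeasurementOperator_merlinFreeTest k r (P.measure_isMeasurement y).nonneg)
    (fun x y hxy ↦ ?_) (fun x y hxy ↦ ?_)
  · obtain ⟨φ, hφ, haccept⟩ := (hP x y).1 hxy
    exact two_thirds_le_acceptProb_merlinFreeTest hr hcomplete (P.measure_isMeasurement y)
      (P.message_pure x) hφ haccept
  · refine (acceptProb_merlinFreeTest_le k r (P.measure_isMeasurement y) (P.message_pure x)
      ((hP x y).2 hxy)).trans ?_
    simpa using hsound

theorem pow_eight_ninths_le (j : ℕ) : (8 / 9 : ℝ) ^ (6 * j) ≤ (1 / 2) ^ j := by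
  rw [pow_mul]
  gcongr
  norm_num

theorem completeness_error_le (hw : 2 ≤ w) :
    (8 / 9 : ℝ) ^ (132 * Nat.log 2 w) ≤ (1 / (12 * (24 * w : ℕ))) ^ 2 := by
  set L := Nat.log 2 w with hL
  have hL1 : 1 ≤ L := Nat.log_pos one_lt_two hw
  have hbound : 12 * (24 * w) ≤ 2 ^ (11 * L) := calc
    12 * (24 * w) ≤ 2 ^ 9 * 2 ^ (L + 1) := by
      have := Nat.lt_pow_succ_log_self one_lt_two w
      rw [← hL] at this
      omega
    _ = 2 ^ (L + 10) := by ring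
    _ ≤ 2 ^ (11 * L) := Nat.pow_le_pow_right two_pos (by omega)
  calc (8 / 9 : ℝ) ^ (132 * L) = (8 / 9) ^ (6 * (22 * L)) := by ring
    _ ≤ (1 / 2) ^ (22 * L) := pow_eight_ninths_le _
    _ = (1 / 2 ^ (11 * L)) ^ 2 := by rw [one_div_pow, one_div_pow, ← pow_mul]; ring
    _ ≤ (1 / (12 * (24 * w : ℕ))) ^ 2 := by
      gcongr
      exact_mod_cast hbound

theorem soundness_error_le {k : ℕ} (hk : 2 ≤ w * k) :
    4 * (((2 : ℝ) ^ w) ^ (2 * k) * ((8 / 9) ^ k) ^ (24 * w)) ≤ 1 / 3 := by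
  have hcard : ((2 : ℝ) ^ w) ^ (2 * k) = 4 ^ (w * k) := by
    rw [← pow_mul, mul_left_comm, pow_mul]
    norm_num
  calc 4 * (((2 : ℝ) ^ w) ^ (2 * k) * ((8 / 9) ^ k) ^ (24 * w))
      = 4 * (4 ^ (w * k) * (8 / 9) ^ (6 * (4 * (w * k)))) := by rw [hcard]; ring
    _ ≤ 4 * (4 ^ (w * k) * (1 / 2) ^ (4 * (w * k))) := by
        gcongr
        exact pow_eight_ninths_le _
    _ = 4 * (1 / 4) ^ (w * k) := by
        rw [pow_mul (1 / 2 : ℝ), ← mul_pow]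
        norm_num
    _ ≤ 4 * (1 / 4) ^ 2 := by
        gcongr ?_ * ?_
        exact pow_le_pow_of_le_one (by norm_num) (by norm_num) hk
    _ ≤ 1 / 3 := by norm_num

theorem natLog_two_le_two_mul_log (w : ℕ) : (Nat.log 2 w : ℝ) ≤ 2 * Real.log w := by
  have hlog2 := Real.log_two_gt_d9
  have hlog : 0 ≤ Real.log w := Real.log_natCast_nonneg w
  have hle : (Nat.log 2 w : ℝ) ≤ Real.log w / Real.log 2 := Real.natLog_le_logb w 2
  refine hle.trans <| (div_le_iff₀ (by linarith)).2 ?_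
  nlinarith

theorem log_le_two_mul_log_sq (hw : 2 ≤ w) : Real.log w ≤ 2 * Real.log w ^ 2 := by
  have hone : (1 : ℝ) ≤ Nat.log 2 w := by exact_mod_cast Nat.log_pos one_lt_two hw
  nlinarith [natLog_two_le_two_mul_log w]

end Assembly

theorem mainTheorem6_general :
    ∃ C : ℝ, 0 < C ∧ ∀ (n m : ℕ) (f : PartialBoolFun n m) (w : ℕ), 2 ≤ w →
      (Q1 f : ℝ) ≤ C * ((QMA1 w f : ℝ) * (w : ℝ) * Real.log (w : ℝ)) := by
  refine ⟨12672, by norm_num, fun n m f w hw ↦ ?_⟩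
  obtain ⟨P, hP⟩ : ∃ P : MerlinProtocol n m (QMA1 w f) w, P.Verifies f :=
    Nat.sInf_mem (QMA1_nonempty w f)
  set L := Nat.log 2 w
  have hL : 1 ≤ L := Nat.log_pos one_lt_two hw
  have hQ1 : Q1 f ≤ QMA1 w f * (2 * (132 * L)) * (24 * w) :=
    hP.Q1_le (by omega) (completeness_error_le hw) (soundness_error_le (by nlinarith))
  calc (Q1 f : ℝ) ≤ 6336 * (QMA1 w f * w * L) := by
        rw [← Nat.cast_le (α := ℝ)] at hQ1
        refine hQ1.trans_eq ?_
        push_cast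
        ring
    _ ≤ 6336 * (QMA1 w f * w * (2 * Real.log w)) := by
        gcongr
        exact natLog_two_le_two_mul_log w
    _ = 12672 * (QMA1 w f * w * Real.log w) := by ring

theorem mainTheorem6 :
    ∃ C : ℝ, 0 < C ∧ ∀ (n m : ℕ) (f : PartialBoolFun n m) (w : ℕ), 2 ≤ w →
      (Q1 f : ℝ) ≤ C * ((QMA1 w f : ℝ) * (w : ℝ) * Real.log (w : ℝ) ^ 2) := by
  obtain ⟨C, hC, h⟩ := mainTheorem6_general
  refine ⟨C * 2, by positivity, fun n m f w hw ↦ (h n m f w hw).trans ?_⟩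
  rw [mul_assoc C, mul_left_comm 2]
  gcongr
  exact log_le_two_mul_log_sq hw
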